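/- Let $A,B\in M_n(\mathbb Z)$ be non-singular. Put $G_A=\{A^{-k}\mathbf x\mid \mathbf x\in\mathbb Z^n,\ k\in\mathbb Z\}\subseteq\mathbb Q^n$, let $h_A\in\mathbb Z[t]$ be the characteristic polynomial of $A$, and let $\mathcal P'(A)$ be the set of primes $p$ with $p\mid\det A$ and $h_A\not\equiv t^n \pmod p$; similarly for $B$. Let $K$ be a finite Galois extension of $\mathbb Q$ containing all eigenvalues of $A$ and $B$, with ring of integers $\mathcal O_K$. For a prime $p$ and a prime ideal $\mathfrak p$ of $\mathcal O_K$ above $p$, let $X_{A,\mathfrak p}\subseteq K^n$ be the sum of the generalized eigenspaces of $A$ for the eigenvalues divisible by $\mathfrak p$, and let $$X_{A,p}=\sum_{\sigma\in\operatorname{Gal}(K/\mathbb Q)}\sigma(X_{A,\mathfrak p}),\qquad X_{A,p_1\cdots p_k}=X_{A,p_1}\cap\cdots\cap X_{A,p_k}$$ for distinct primes $p_1,\dots,p_k$ (the space $X_{A,p}$ does not depend on the choice of $\mathfrak p$ above $p$). Write $h_A=h_1\cdots h_s$ with $h_i=r_i^{u_i}$, where $r_1,\dots,r_s\in\mathbb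 Z[t]$ are distinct, monic and irreducible and $u_i\ge 1$, and let $$h_{A,p_1\cdots p_k}=\prod_{p_1\cdots p_k\,\mid\, h_i(0)}h_i .$$ Define $X_{B,p_1\cdots p_k}$ and $h_{B,p_1\cdots p_k}$ in the same way. Let $T\in\operatorname{GL}_n(\mathbb Q)$ satisfy $T(G_A)=G_B$. Then $\mathcal P'(A)=\mathcal P'(B)$, and for all $k$ and all distinct $p_1,\dots,p_k\in\mathcal P'(A)=\mathcal P'(B)$, $$T(X_{A,p_1\cdots p_k})=X_{B,p_1\cdots p_k}.$$ In particular, $\deg h_{A,p_1\cdots p_k}=\deg h_{B,p_1\cdots p_k}$. -/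

import Mathlib

open Polynomial

namespace Solenoid

noncomputable section

/-- `G_A = {A⁻ᵏ x | x ∈ ℤⁿ, k ∈ ℤ} ⊆ ℚⁿ`, as a set of column vectors. -/
def groupG {n : ℕ} (A : Matrix (Fin n) (Fin n) ℤ) : Set (Fin n → ℚ) :=
  {v | ∃ (k : ℤ) (x : Fin n → ℤ),
    v = ((A.map (Int.cast : ℤ → ℚ)) ^ (-k)).mulVec (fun i => (x i : ℚ))}

/-- `𝒫(A)`: the prime divisors of `det A`. -/
def primesP {n : ℕ} (A : Matrix (Fin n) (Fin n) ℤ) : Set ℕ :=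
  {p | p.Prime ∧ (p : ℤ) ∣ A.det}

/-- `𝒫'(A)`: the primes `p ∈ 𝒫(A)` such that `h_A ≢ xⁿ (mod p)`. -/
def primesP' {n : ℕ} (A : Matrix (Fin n) (Fin n) ℤ) : Set ℕ :=
  {p | p ∈ primesP A ∧ A.charpoly.map (Int.castRingHom (ZMod p)) ≠ X ^ n}

section Field

variable (K : Type*) [Field K]

/-- The `K`-linear map of `Kⁿ` given by an integer matrix. -/
def intEnd {n : ℕ} (A : Matrix (Fin n) (Fin n) ℤ) : Module.End K (Fin n → K) :=
  Matrix.toLin' (A.map (Int.cast : ℤ → K))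

/-- The `K`-linear map of `Kⁿ` given by an invertible rational matrix. -/
def ratEnd [CharZero K] {n : ℕ} (T : GL (Fin n) ℚ) : Module.End K (Fin n → K) :=
  Matrix.toLin' ((T : Matrix (Fin n) (Fin n) ℚ).map (algebraMap ℚ K))

variable {K}

/-- `X_{A,𝔭}`: the sum of the generalized eigenspaces `K(A,λ)` over the eigenvalues `λ` of `A`
divisible by `𝔭`. (For `λ` not an eigenvalue the space `K(A,λ)` is zero; the eigenvalues of `A`
are algebraic integers.) -/
def spaceXIdeal {n : ℕ} (A : Matrix (Fin n) (Fin n) ℤ) (𝔭 : Ideal (NumberField.RingOfIntegers K)) :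
    Submodule K (Fin n → K) :=
  ⨆ l ∈ 𝔭, (intEnd K A).maxGenEigenspace (l : K)

/-- `σ(W)`, the image of a subspace `W ⊆ Kⁿ` under the coordinatewise action of a field
automorphism. -/
def galoisImage [CharZero K] {n : ℕ} (σ : K ≃ₐ[ℚ] K) (W : Submodule K (Fin n → K)) :
    Submodule K (Fin n → K) where
  carrier := (fun v i => σ (v i)) '' (W : Set (Fin n → K))
  zero_mem' := ⟨0, W.zero_mem, by ext i; simp⟩
  add_mem' := by
    rintro _ _ ⟨v, hv, rfl⟩ ⟨w, hw, rfl⟩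
    exact ⟨v + w, W.add_mem hv hw, by ext i; simp⟩
  smul_mem' := by
    rintro c _ ⟨v, hv, rfl⟩
    exact ⟨σ.symm c • v, W.smul_mem _ hv, by ext i; simp⟩

/-- `X_{A,p} = ∑_{σ ∈ Gal(K/ℚ)} σ(X_{A,𝔭})`, computed from a prime `𝔭` above `p`. -/
def spaceX [CharZero K] {n : ℕ} (A : Matrix (Fin n) (Fin n) ℤ)
    (𝔭 : Ideal (NumberField.RingOfIntegers K)) : Submodule K (Fin n → K) :=
  ⨆ σ : K ≃ₐ[ℚ] K, galoisImage σ (spaceXIdeal A 𝔭)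

/-- `X_{A,p₁⋯p_k} = X_{A,p₁} ∩ ⋯ ∩ X_{A,p_k}`, computed from primes `𝔭ᵢ` above `pᵢ`. -/
def spaceXMulti [CharZero K] {n k : ℕ} (A : Matrix (Fin n) (Fin n) ℤ)
    (𝔭 : Fin k → Ideal (NumberField.RingOfIntegers K)) : Submodule K (Fin n → K) :=
  ⨅ i, spaceX A (𝔭 i)

end Field

open Classical in
/-- `h_{A,m}`, for `m = p₁⋯p_k`: writing `h_A = ∏ rᵢ ^ uᵢ` with distinct monic irreducible
`rᵢ ∈ ℤ[t]`, this is the product of those `hᵢ = rᵢ ^ uᵢ` for which `m ∣ hᵢ(0)`. -/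
def polyH {n : ℕ} (A : Matrix (Fin n) (Fin n) ℤ) (m : ℕ) : ℤ[X] :=
  let F := UniqueFactorizationMonoid.normalizedFactors A.charpoly
  ∏ r ∈ F.toFinset with (m : ℤ) ∣ (r ^ F.count r).eval 0, r ^ F.count r

end

end Solenoid

/-! Fix a prime p and call a row vector w bounded if the values w·v, v ∈ G_A, have a common
denominator up to integers prime to p (`IsBoundedAt`). Since T(G_A) = G_B, w is bounded on G_B iff
wT is bounded on G_A. Boundedness is algebraic: w is bounded on G_A iff wP(A) = 0 for some P ∈ ℤ[t]
with p ∤ P(0) (`isBoundedAt_of_vecMul_aeval_eq_zero`, `exists_vecMul_aeval_eq_zero`). The cofactor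
of h_{A,p} in h_A is such a P, and h_{A,p} is coprime over ℚ to every such P. So the bounded rows
form the row space of h_{A,p}(A), and the vectors they all annihilate form ker h_{A,p}(A). Hence T
carries ker h_{A,p}(A) onto ker h_{B,p}(B) (`aeval_polyH_mulVec_eq_zero_iff`).

Moreover X_{A,p} = ker h_{A,p}(A) (`spaceX_eq_ker`): an irreducible factor r of h_A has a root in 𝔭
iff p ∣ r(0), and the Galois group permutes the roots of r transitively. For several primes one
intersects, and deg h_{A,m} is the dimension of ker h_{A,m}(A), because h_{A,m} is coprime to its
cofactor.

Finally 𝒫' depends only on the isomorphism class of the group: p ∤ det A iff every row is bounded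
(`not_dvd_det_iff`), and h_A ≡ tⁿ mod p iff G_A is p-divisible (`charpoly_map_eq_iff`). -/

namespace Solenoid

/-! ### Integer polynomials evaluated at integer matrices -/

section Evaluation

variable {n : ℕ}

lemma aeval_map_intCast (K : Type*) [Field K] (A : Matrix (Fin n) (Fin n) ℤ) (P : ℤ[X]) :
    aeval (A.map (Int.cast : ℤ → K)) P = (aeval A P).map (Int.cast : ℤ → K) := by
  have h := Polynomial.map_aeval_eq_aeval_map (p := P) (a := A) (φ := RingHom.id ℤ)
    (ψ := (Int.castRingHom K).mapMatrix) (by ext i; simp)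
  simpa using h.symm

lemma aeval_charpoly_map_intCast (K : Type*) [Field K] (A : Matrix (Fin n) (Fin n) ℤ) :
    aeval (A.map (Int.cast : ℤ → K)) A.charpoly = 0 := by
  rw [aeval_map_intCast, Matrix.aeval_self_charpoly]
  ext i j
  simp

lemma isUnit_det_map_intCast {A : Matrix (Fin n) (Fin n) ℤ} (hA : A.det ≠ 0) :
    IsUnit (A.map (Int.cast : ℤ → ℚ)).det := by
  have : (A.map (Int.cast : ℤ → ℚ)).det = (A.det : ℚ) :=
    ((Int.castRingHom ℚ).map_det A).symm
  rw [this, isUnit_iff_ne_zero]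
  exact_mod_cast hA

lemma aeval_C_eq_smul_one (M : Matrix (Fin n) (Fin n) ℚ) (z : ℤ) :
    aeval M (C z) = (z : ℚ) • (1 : Matrix (Fin n) (Fin n) ℚ) := by
  rw [aeval_C, eq_intCast]
  ext i j
  simp [Matrix.intCast_apply, Matrix.one_apply]

end Evaluation

/-! ### p-integral rationals and bounded row vectors -/

section Integrality

variable (p : ℕ) [hp : Fact p.Prime]

/-- The integers not divisible by the prime `p`. -/
def primeToSubmonoid : Submonoid ℤ where
  carrier := {s | ¬ (p : ℤ) ∣ s}
  one_mem' h := (Nat.prime_iff_prime_int.mp hp.out).not_dvd_one h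
  mul_mem' ha hb h := ((Nat.prime_iff_prime_int.mp hp.out).dvd_or_dvd h).elim ha hb

lemma primeToSubmonoid_le : primeToSubmonoid p ≤ nonZeroDivisors ℤ := by
  intro s hs
  rw [mem_nonZeroDivisors_iff_ne_zero]
  rintro rfl
  exact hs (dvd_zero _)

/-- The ring of `p`-integral rational numbers. -/
noncomputable def localInt : Subalgebra ℤ ℚ :=
  Localization.subalgebra.ofField ℚ (primeToSubmonoid p) (primeToSubmonoid_le p)

instance : IsLocalization (primeToSubmonoid p) (localInt p) :=
  Localization.subalgebra.isLocalization_ofField ℚ _ _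

instance : IsNoetherianRing (localInt p) :=
  IsLocalization.isNoetherianRing (primeToSubmonoid p) _ inferInstance

lemma intCast_mem_localInt (z : ℤ) : (z : ℚ) ∈ localInt p := by
  simp

lemma inv_mem_localInt {s : ℤ} (hs : ¬ (p : ℤ) ∣ s) : (s : ℚ)⁻¹ ∈ localInt p := by
  refine ⟨1, s, hs, ?_⟩
  simp

/-- A row vector `w` is `p`-bounded on `G` if the values `w ⬝ᵥ v`, `v ∈ G`, have a common
denominator up to integers prime to `p`. -/
def IsBoundedAt {n : ℕ} (G : Set (Fin n → ℚ)) (w : Fin n → ℚ) : Prop :=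
  ∃ d : ℚ, d ≠ 0 ∧ ∀ v ∈ G, d * (w ⬝ᵥ v) ∈ localInt p

variable {p}

lemma isBoundedAt_image {n : ℕ} {G : Set (Fin n → ℚ)} {w : Fin n → ℚ}
    (T : Matrix (Fin n) (Fin n) ℚ) :
    IsBoundedAt p ((fun v => T.mulVec v) '' G) w ↔ IsBoundedAt p G (Matrix.vecMul w T) := by
  simp [IsBoundedAt, Matrix.dotProduct_mulVec]

lemma exists_common_denominator {n : ℕ} (w : Fin n → ℚ) :
    ∃ (d : ℤ) (z : Fin n → ℤ), d ≠ 0 ∧ ∀ i, (d : ℚ) * w i = z i := by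
  obtain ⟨b, hb⟩ := IsLocalization.exist_integer_multiples_of_finset (nonZeroDivisors ℤ)
    (Finset.univ.image w)
  have : ∀ i, ∃ z : ℤ, (b : ℚ) * w i = z := fun i => by
    obtain ⟨z, hz⟩ := hb (w i) (by simp)
    refine ⟨z, ?_⟩
    simpa [Submonoid.smul_def, eq_comm] using hz
  choose z hz using this
  exact ⟨b, z, nonZeroDivisors.coe_ne_zero b, hz⟩

end Integrality

/-! ### Algebraic characterization of boundedness -/

section Bounded

variable {n p : ℕ} [hp : Fact p.Prime] {A : Matrix (Fin n) (Fin n) ℤ}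

lemma map_intCast_mulVec (M : Matrix (Fin n) (Fin n) ℤ) (x : Fin n → ℤ) :
    (M.map (Int.cast : ℤ → ℚ)).mulVec (fun i => (x i : ℚ)) = fun i => ((M.mulVec x i : ℤ) : ℚ) := by
  ext i
  simp [Matrix.mulVec, dotProduct]

lemma map_intCast_pow (M : Matrix (Fin n) (Fin n) ℤ) (k : ℕ) :
    (M ^ k).map (Int.cast : ℤ → ℚ) = M.map (Int.cast : ℤ → ℚ) ^ k :=
  map_pow (Int.castRingHom ℚ).mapMatrix M k

/-- Elements of `G_A` are of the form `A⁻ᵏ x` with `k : ℕ`. -/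
lemma exists_nat_of_mem_groupG {v : Fin n → ℚ} (hv : v ∈ groupG A) :
    ∃ (k : ℕ) (x : Fin n → ℤ),
      v = ((A.map (Int.cast : ℤ → ℚ))⁻¹ ^ k).mulVec (fun i => (x i : ℚ)) := by
  obtain ⟨k, x, rfl⟩ := hv
  obtain ⟨k, rfl | rfl⟩ := Int.eq_nat_or_neg k
  · exact ⟨k, x, by rw [Matrix.zpow_neg_natCast, Matrix.inv_pow']⟩
  · refine ⟨0, (A ^ k).mulVec x, ?_⟩
    rw [neg_neg, zpow_natCast, ← map_intCast_pow, map_intCast_mulVec]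
    simp

lemma inv_pow_mulVec_mem_groupG (k : ℕ) (x : Fin n → ℤ) :
    ((A.map (Int.cast : ℤ → ℚ))⁻¹ ^ k).mulVec (fun i => (x i : ℚ)) ∈ groupG A :=
  ⟨k, x, by rw [Matrix.zpow_neg_natCast, Matrix.inv_pow']⟩

/-- Write P = Qt + c with c = P(0). Then wA⁻¹ = -c⁻¹wQ(A), hence wA⁻ᵏ = (-c⁻¹)ᵏwQ(A)ᵏ: apart from
the fixed denominator of w, only powers of c, which is prime to p, are inverted. -/
lemma isBoundedAt_of_vecMul_aeval_eq_zero (hA : A.det ≠ 0) {w : Fin n → ℚ} {P : ℤ[X]}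
    (hP : ¬ (p : ℤ) ∣ P.eval 0) (hw : Matrix.vecMul w (aeval (A.map (Int.cast : ℤ → ℚ)) P) = 0) :
    IsBoundedAt p (groupG A) w := by
  set M := A.map (Int.cast : ℤ → ℚ) with hM
  have hu : IsUnit M.det := isUnit_det_map_intCast hA
  set c := P.eval 0 with hc
  have hc0 : (c : ℚ) ≠ 0 := by
    rw [Int.cast_ne_zero]
    intro h
    exact hP (h ▸ dvd_zero _)
  have hdec : aeval M P = aeval M P.divX * M + (c : ℚ) • (1 : Matrix (Fin n) (Fin n) ℚ) := by
    conv_lhs => rw [← P.divX_mul_X_add]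
    rw [map_add, map_mul, aeval_X, aeval_C_eq_smul_one, hc, ← coeff_zero_eq_eval_zero]
  have hstep : Matrix.vecMul w M⁻¹ = -(c : ℚ)⁻¹ • Matrix.vecMul w (aeval M P.divX) := by
    have h1 : Matrix.vecMul (Matrix.vecMul w (aeval M P)) M⁻¹ = 0 := by simp [hw]
    rw [Matrix.vecMul_vecMul, hdec, add_mul, mul_assoc, Matrix.mul_nonsing_inv _ hu, mul_one,
      smul_mul_assoc, one_mul, Matrix.vecMul_add, Matrix.vecMul_smul] at h1
    rw [eq_neg_of_add_eq_zero_left h1]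
    ext i
    simp [hc0]
  have hcomm : Commute (aeval M P.divX) M⁻¹ := by
    have h2 : aeval M P.divX * M = M * aeval M P.divX := by
      simpa using congrArg (aeval M) (mul_comm P.divX X)
    calc aeval M P.divX * M⁻¹ = M⁻¹ * (M * aeval M P.divX) * M⁻¹ := by
          rw [← mul_assoc, Matrix.nonsing_inv_mul _ hu, one_mul]
      _ = M⁻¹ * aeval M P.divX := by
          rw [← h2, mul_assoc, mul_assoc, Matrix.mul_nonsing_inv _ hu, mul_one]
  have hpow : ∀ k : ℕ, Matrix.vecMul w (M⁻¹ ^ k) =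
      (-(c : ℚ)⁻¹) ^ k • Matrix.vecMul w (aeval M P.divX ^ k) := by
    intro k
    induction k with
    | zero => simp
    | succ k ih =>
      rw [pow_succ, ← Matrix.vecMul_vecMul, ih, Matrix.smul_vecMul, Matrix.vecMul_vecMul,
        (hcomm.pow_left k).eq, ← Matrix.vecMul_vecMul, hstep, Matrix.smul_vecMul,
        Matrix.vecMul_vecMul, ← pow_succ', smul_smul, ← pow_succ]
  obtain ⟨d, z, hd, hz⟩ := exists_common_denominator w
  refine ⟨d, by exact_mod_cast hd, fun v hv => ?_⟩
  obtain ⟨k, x, rfl⟩ := exists_nat_of_mem_groupG hv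
  rw [Matrix.dotProduct_mulVec, hpow, smul_dotProduct, ← Matrix.dotProduct_mulVec, hM,
    aeval_map_intCast, ← map_intCast_pow, map_intCast_mulVec, smul_eq_mul, mul_left_comm]
  refine mul_mem (pow_mem (neg_mem (inv_mem_localInt p hP)) k) ?_
  rw [dotProduct, Finset.mul_sum]
  refine sum_mem fun i _ => ?_
  rw [← mul_assoc, hz, ← Int.cast_mul]
  exact intCast_mem_localInt p _

/-- For a common denominator d, all rows d·wA⁻ʲ lie in the noetherian module of p-integral vectors,
so some wA⁻ᵐ is a p-integral combination of the earlier ones. Clearing denominators by s prime to p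
and multiplying by Aᵐ gives P. -/
lemma exists_vecMul_aeval_eq_zero (hA : A.det ≠ 0) {w : Fin n → ℚ}
    (hw : IsBoundedAt p (groupG A) w) :
    ∃ P : ℤ[X], ¬ (p : ℤ) ∣ P.eval 0 ∧
      Matrix.vecMul w (aeval (A.map (Int.cast : ℤ → ℚ)) P) = 0 := by
  set M := A.map (Int.cast : ℤ → ℚ) with hM
  have hu : IsUnit M.det := isUnit_det_map_intCast hA
  obtain ⟨d, hd, hw⟩ := hw
  -- Pairing with A⁻ʲeᵢ ∈ G_A reads off the i-th entry of wA⁻ʲ.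
  have hmem : ∀ (j : ℕ) (i : Fin n), d * Matrix.vecMul w (M⁻¹ ^ j) i ∈ localInt p := by
    intro j i
    have := hw _ (inv_pow_mulVec_mem_groupG j (Pi.single i 1))
    rw [Matrix.dotProduct_mulVec] at this
    convert this using 2
    simp [dotProduct, Pi.single_apply, hM]
  let u : ℕ → Fin n → localInt p := fun j i => ⟨_, hmem j i⟩
  let f : ℕ →o Submodule (localInt p) (Fin n → localInt p) :=
    ⟨fun k => Submodule.span _ (u '' (Finset.range k : Finset ℕ)), fun a b hab =>
      Submodule.span_mono (Set.image_mono (by simpa using hab))⟩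
  obtain ⟨m, hm⟩ := monotone_stabilizes_iff_noetherian.mpr
    (inferInstance : IsNoetherian (localInt p) (Fin n → localInt p)) f
  have hum : u m ∈ Submodule.span (localInt p) (u '' (Finset.range m : Finset ℕ)) := by
    change u m ∈ f m
    rw [hm (m + 1) (Nat.le_succ m)]
    exact Submodule.subset_span ⟨m, by simp, rfl⟩
  rw [Submodule.mem_span_image_finset_iff_exists_fun'] at hum
  obtain ⟨a, ha⟩ := hum
  obtain ⟨s, hs⟩ := IsLocalization.exist_integer_multiples_of_finset (primeToSubmonoid p)
    ((Finset.range m).image a)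
  have : ∀ j ∈ Finset.range m, ∃ b : ℤ, (b : ℚ) = (s : ℤ) * (a j : ℚ) := fun j hj => by
    obtain ⟨b, hb⟩ := hs (a j) (Finset.mem_image_of_mem a hj)
    refine ⟨b, ?_⟩
    simpa [Submonoid.smul_def] using congrArg (Subtype.val) hb
  choose! b hb using this
  have hrel : (s : ℚ) • Matrix.vecMul w (M⁻¹ ^ m) =
      ∑ j ∈ Finset.range m, (b j : ℚ) • Matrix.vecMul w (M⁻¹ ^ j) := by
    ext i
    have h1 := congrArg Subtype.val (congrFun ha i)
    simp only [Finset.sum_apply, Pi.smul_apply, smul_eq_mul, AddSubmonoidClass.coe_finsetSum,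
      MulMemClass.coe_mul, u] at h1
    apply mul_left_cancel₀ hd
    simp only [Pi.smul_apply, smul_eq_mul, Finset.sum_apply]
    rw [mul_left_comm, ← h1, Finset.mul_sum, Finset.mul_sum]
    refine Finset.sum_congr rfl fun j hj => ?_
    rw [hb j hj]
    ring
  -- All exponents m - j are positive, so the constant term is s.
  refine ⟨C (s : ℤ) - ∑ j ∈ Finset.range m, C (b j) * X ^ (m - j), ?_, ?_⟩
  · have : (C (s : ℤ) - ∑ j ∈ Finset.range m, C (b j) * X ^ (m - j)).eval 0 = s := by
      simp only [eval_sub, eval_C, eval_finsetSum, eval_mul, eval_pow, eval_X, sub_eq_self]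
      refine Finset.sum_eq_zero fun j hj => ?_
      rw [zero_pow (Nat.sub_ne_zero_of_lt (Finset.mem_range.mp hj)), mul_zero]
    rw [this]
    exact s.2
  · have hcancel : ∀ j ≤ m, M⁻¹ ^ j * M ^ m = M ^ (m - j) := fun j hj => by
      obtain ⟨e, rfl⟩ := Nat.exists_eq_add_of_le hj
      rw [pow_add, ← mul_assoc, ← Commute.mul_pow, Matrix.nonsing_inv_mul _ hu, one_pow, one_mul,
        Nat.add_sub_cancel_left]
      rw [Commute, SemiconjBy, Matrix.nonsing_inv_mul _ hu, Matrix.mul_nonsing_inv _ hu]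
    have h2 := congrArg (fun y => Matrix.vecMul y (M ^ m)) hrel
    simp only [Matrix.sum_vecMul, Matrix.smul_vecMul, Matrix.vecMul_vecMul] at h2
    rw [hcancel m le_rfl, Nat.sub_self, pow_zero, Matrix.vecMul_one] at h2
    rw [map_sub, Matrix.vecMul_sub, map_sum, Matrix.vecMul_sum]
    have h3 : ∀ (z : ℤ) (N : Matrix (Fin n) (Fin n) ℚ),
        Matrix.vecMul w (aeval M (C z) * N) = (z : ℚ) • Matrix.vecMul w N := fun z N => by
      rw [aeval_C_eq_smul_one, smul_mul_assoc, one_mul, Matrix.vecMul_smul]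
    have h4 := h3 s 1
    rw [mul_one, Matrix.vecMul_one] at h4
    rw [h4, h2, sub_eq_zero]
    refine Finset.sum_congr rfl fun j hj => ?_
    rw [map_mul, h3, hcancel j (Finset.mem_range.mp hj).le, map_pow, aeval_X]

end Bounded
lemma not_dvd_eval_charpoly {n p : ℕ} {A : Matrix (Fin n) (Fin n) ℤ} (h : ¬ (p : ℤ) ∣ A.det) :
    ¬ (p : ℤ) ∣ A.charpoly.eval 0 := by
  rw [← coeff_zero_eq_eval_zero]
  rw [Matrix.det_eq_sign_charpoly_coeff] at h
  exact fun h' => h (h'.mul_left _)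

/-! ### The set 𝒫' in terms of the group -/

section PrimeSets

variable {n p : ℕ} [hp : Fact p.Prime] {A B : Matrix (Fin n) (Fin n) ℤ}

lemma not_dvd_det_of_aeval_eq_zero {P : ℤ[X]} (hP : ¬ (p : ℤ) ∣ P.eval 0) (h : aeval A P = 0) :
    ¬ (p : ℤ) ∣ A.det := by
  intro hdvd
  have h1 : aeval A P.divX * A = (-P.eval 0) • (1 : Matrix (Fin n) (Fin n) ℤ) := by
    rw [neg_smul, eq_neg_iff_add_eq_zero, ← h]
    conv_rhs => rw [← P.divX_mul_X_add]
    rw [map_add, map_mul, aeval_X, aeval_C, coeff_zero_eq_eval_zero, Algebra.algebraMap_eq_smul_one]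
  have h2 := congrArg Matrix.det h1
  rw [Matrix.det_mul, Matrix.det_smul, Matrix.det_one, mul_one] at h2
  have h3 : (p : ℤ) ∣ (-P.eval 0) ^ Fintype.card (Fin n) := h2 ▸ hdvd.mul_left _
  exact hP ((dvd_neg).mp ((Nat.prime_iff_prime_int.mp hp.out).dvd_of_dvd_pow h3))

/-- `p ∤ det A` if and only if `G_A` is `p`-bounded. -/
lemma not_dvd_det_iff (hA : A.det ≠ 0) :
    ¬ (p : ℤ) ∣ A.det ↔ ∀ w, IsBoundedAt p (groupG A) w := by
  constructor
  · intro h w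
    exact isBoundedAt_of_vecMul_aeval_eq_zero hA (not_dvd_eval_charpoly h)
      (by rw [aeval_charpoly_map_intCast, Matrix.vecMul_zero])
  · intro h
    -- Each basis row has its own polynomial; their product kills all of them and still has constant
    -- term prime to p.
    choose P hP hw using fun i => exists_vecMul_aeval_eq_zero hA (h (Pi.single i 1))
    refine not_dvd_det_of_aeval_eq_zero (P := ∏ i, P i) ?_ ?_
    · rw [eval_prod, (Nat.prime_iff_prime_int.mp hp.out).dvd_finsetProd_iff]
      rintro ⟨i, -, hi⟩
      exact hP i hi
    · have h1 : aeval (A.map (Int.cast : ℤ → ℚ)) (∏ i, P i) = 0 := by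
        ext i j
        have : Matrix.vecMul (Pi.single i 1) (aeval (A.map (Int.cast : ℤ → ℚ)) (∏ i, P i)) = 0 := by
          rw [← Finset.mul_prod_erase _ _ (Finset.mem_univ i), map_mul, ← Matrix.vecMul_vecMul, hw,
            Matrix.zero_vecMul]
        simpa using congrFun this j
      rw [aeval_map_intCast] at h1
      ext i j
      simpa using congrFun (congrFun h1 i) j

/-- `h_A ≡ tⁿ (mod p)` if and only if `G_A` is `p`-divisible. -/
lemma charpoly_map_eq_iff (hA : A.det ≠ 0) :
    A.charpoly.map (Int.castRingHom (ZMod p)) = X ^ n ↔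
      ∀ v ∈ groupG A, (p : ℚ)⁻¹ • v ∈ groupG A := by
  have hp0 : (p : ℚ) ≠ 0 := by exact_mod_cast hp.out.ne_zero
  set M := A.map (Int.cast : ℤ → ℚ) with hM
  have hu : IsUnit M.det := isUnit_det_map_intCast hA
  have hcancel : ∀ k : ℕ, M⁻¹ ^ k * M ^ k = 1 := fun k => by
    rw [Matrix.inv_pow', Matrix.nonsing_inv_mul]
    rw [Matrix.det_pow]
    exact hu.pow k
  have hmod : ∀ k : ℕ, (A.map (Int.castRingHom (ZMod p))) ^ k =
      (A ^ k).map (Int.castRingHom (ZMod p)) := fun k =>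
    (map_pow (Int.castRingHom (ZMod p)).mapMatrix A k).symm
  rw [← Matrix.charpoly_map]
  constructor
  · intro h v hv
    obtain ⟨k, x, rfl⟩ := exists_nat_of_mem_groupG hv
    -- Cayley–Hamilton mod p gives Aⁿ = pC with C integral, so p⁻¹A⁻ᵏ = A⁻⁽ᵏ⁺ⁿ⁾C.
    have h1 : (A ^ n).map (Int.castRingHom (ZMod p)) = 0 := by
      rw [← hmod]
      have := Matrix.aeval_self_charpoly (A.map (Int.castRingHom (ZMod p)))
      rwa [h, map_pow, aeval_X] at this
    have h2 : ∀ i j, ∃ c : ℤ, (A ^ n) i j = p * c := fun i j => by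
      have := congrFun (congrFun h1 i) j
      exact (ZMod.intCast_zmod_eq_zero_iff_dvd _ p).mp (by simpa using this)
    choose c hc using h2
    have h3 : M ^ n = (p : ℚ) • (Matrix.of c).map (Int.cast : ℤ → ℚ) := by
      rw [hM, ← map_intCast_pow]
      ext i j
      simp [hc]
    have h4 : (p : ℚ)⁻¹ • (M⁻¹ ^ k) = M⁻¹ ^ (k + n) * (Matrix.of c).map (Int.cast : ℤ → ℚ) := by
      have h5 : (Matrix.of c).map (Int.cast : ℤ → ℚ) = (p : ℚ)⁻¹ • M ^ n := by
        rw [h3, smul_smul, inv_mul_cancel₀ hp0, one_smul]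
      rw [h5, mul_smul_comm, pow_add, mul_assoc, hcancel n, mul_one]
    rw [← Matrix.smul_mulVec, h4, ← Matrix.mulVec_mulVec, map_intCast_mulVec]
    exact inv_pow_mulVec_mem_groupG _ _
  · intro h
    have h1 : ∀ i, ∃ (k : ℕ) (x : Fin n → ℤ), (A ^ k).mulVec (Pi.single i 1) = (p : ℤ) • x := by
      intro i
      obtain ⟨k, x, hx⟩ := exists_nat_of_mem_groupG
        (h _ (inv_pow_mulVec_mem_groupG (A := A) 0 (Pi.single i 1)))
      refine ⟨k, x, ?_⟩
      have h2 := congrArg (fun y => (p : ℚ) • (M ^ k).mulVec y) hx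
      simp only [Matrix.mulVec_smul, smul_smul, mul_inv_cancel₀ hp0, one_smul] at h2
      rw [pow_zero, Matrix.one_mulVec, Matrix.mulVec_mulVec, mul_eq_one_comm.mp (hcancel k),
        Matrix.one_mulVec, hM, ← map_intCast_pow, map_intCast_mulVec] at h2
      ext i
      have h3 := congrFun h2 i
      simp only [Pi.smul_apply, smul_eq_mul] at h3 ⊢
      exact_mod_cast h3
    choose k x hx using h1
    -- The exponent k depends on the basis vector; the sum dominates all of them, so A is nilpotent
    -- mod p.
    have h2 : (A.map (Int.castRingHom (ZMod p))) ^ (∑ i, k i) = 0 := by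
      rw [hmod]
      ext i j
      have h3 : (A ^ (∑ i, k i)).mulVec (Pi.single j 1) =
          (p : ℤ) • (A ^ (∑ i ∈ Finset.univ.erase j, k i)).mulVec (x j) := by
        rw [← Finset.sum_erase_add _ _ (Finset.mem_univ j), pow_add, ← Matrix.mulVec_mulVec, hx,
          Matrix.mulVec_smul]
      have h4 := congrFun h3 i
      simp only [Matrix.mulVec_single_one, Matrix.col_apply, Pi.smul_apply, smul_eq_mul] at h4
      simp [h4]
    have h3 := Matrix.isNilpotent_charpoly_sub_pow_of_isNilpotent ⟨_, h2⟩
    simpa [sub_eq_zero] using h3.eq_zero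

lemma isBoundedAt_groupG_iff {T : Matrix (Fin n) (Fin n) ℚ}
    (hT : (fun v => T.mulVec v) '' groupG A = groupG B) (w : Fin n → ℚ) :
    IsBoundedAt p (groupG B) w ↔ IsBoundedAt p (groupG A) (Matrix.vecMul w T) := by
  rw [← hT, isBoundedAt_image]

end PrimeSets

variable {n : ℕ} {A B : Matrix (Fin n) (Fin n) ℤ}

lemma primesP'_subset (hA : A.det ≠ 0) (hB : B.det ≠ 0) {T : Matrix (Fin n) (Fin n) ℚ}
    (hT : (fun v => T.mulVec v) '' groupG A = groupG B) (hTu : IsUnit T.det) :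
    primesP' A ⊆ primesP' B := by
  rintro p ⟨⟨hp, hdvd⟩, hne⟩
  have : Fact p.Prime := ⟨hp⟩
  refine ⟨⟨hp, ?_⟩, ?_⟩
  · contrapose! hdvd
    rw [not_dvd_det_iff hB] at hdvd
    rw [not_dvd_det_iff hA]
    intro w
    have := (isBoundedAt_groupG_iff hT _).mp (hdvd (Matrix.vecMul w T⁻¹))
    rwa [Matrix.vecMul_vecMul, Matrix.nonsing_inv_mul _ hTu, Matrix.vecMul_one] at this
  · contrapose! hne
    rw [charpoly_map_eq_iff hB] at hne
    rw [charpoly_map_eq_iff hA]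
    intro v hv
    have h1 := hne _ (hT ▸ Set.mem_image_of_mem _ hv)
    rw [← hT] at h1
    obtain ⟨u, hu, huv⟩ := h1
    have h2 := congrArg (fun y => T⁻¹.mulVec y) huv
    simp only [Matrix.mulVec_smul, Matrix.mulVec_mulVec, Matrix.nonsing_inv_mul _ hTu,
      Matrix.one_mulVec] at h2
    rwa [← h2]

lemma image_groupG_symm {T : Matrix (Fin n) (Fin n) ℚ} (hTu : IsUnit T.det)
    (hT : (fun v => T.mulVec v) '' groupG A = groupG B) :
    (fun v => T⁻¹.mulVec v) '' groupG B = groupG A := by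
  rw [← hT, Set.image_image]
  simp [Matrix.nonsing_inv_mul _ hTu]

/-! ### Coprimality over a field of characteristic zero -/

section Coprime

variable (K : Type*) [Field K] [CharZero K]

lemma isCoprime_map_of_not_dvd {r P : ℤ[X]} (hr : Irreducible r) (hm : r.Monic) (h : ¬ r ∣ P) :
    IsCoprime (r.map (Int.castRingHom K)) (P.map (Int.castRingHom K)) := by
  have h1 : Irreducible (r.map (algebraMap ℤ ℚ)) :=
    (hm.irreducible_iff_irreducible_map_fraction_map).mp hr
  have h2 : IsCoprime (r.map (algebraMap ℤ ℚ)) (P.map (algebraMap ℤ ℚ)) := by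
    rw [h1.coprime_iff_not_dvd, Polynomial.map_dvd_map _ (by simpa using Int.cast_injective) hm]
    exact h
  have h3 := h2.map (mapRingHom (algebraMap ℚ K))
  simp only [coe_mapRingHom, map_map] at h3
  have h4 : (algebraMap ℚ K).comp (algebraMap ℤ ℚ) = Int.castRingHom K := RingHom.ext_int _ _
  rwa [h4] at h3

lemma isCoprime_map_of_dvd_eval {p : ℕ} {r P : ℤ[X]} (hr : Irreducible r) (hm : r.Monic)
    (hrp : (p : ℤ) ∣ r.eval 0) (hP : ¬ (p : ℤ) ∣ P.eval 0) :
    IsCoprime (r.map (Int.castRingHom K)) (P.map (Int.castRingHom K)) :=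
  isCoprime_map_of_not_dvd K hr hm fun h => hP (hrp.trans (eval_dvd h))

variable {K}

omit [CharZero K] in
lemma aeval_map_intCastRingHom {n : ℕ} (a : Matrix (Fin n) (Fin n) K) (P : ℤ[X]) :
    aeval a (P.map (Int.castRingHom K)) = aeval a P := by
  rw [← algebraMap_int_eq, aeval_map_algebraMap]

omit [CharZero K] in
lemma eq_zero_of_isCoprime {n : ℕ} {M : Matrix (Fin n) (Fin n) K} {P Q : ℤ[X]}
    (h : IsCoprime (P.map (Int.castRingHom K)) (Q.map (Int.castRingHom K))) {x : Fin n → K}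
    (hP : (aeval M P).mulVec x = 0) (hQ : (aeval M Q).mulVec x = 0) : x = 0 := by
  obtain ⟨U, V, hUV⟩ := h
  have h1 := congrArg (fun q => (aeval M q).mulVec x) hUV
  simp only [map_add, map_mul, map_one, aeval_map_intCastRingHom, Matrix.add_mulVec,
    ← Matrix.mulVec_mulVec, hP, hQ, Matrix.mulVec_zero, add_zero, Matrix.one_mulVec] at h1
  exact h1.symm

end Coprime

/-! ### Primary factorization of the characteristic polynomial -/

section Factors

variable {n : ℕ} (A : Matrix (Fin n) (Fin n) ℤ)

open Classical in
/-- The distinct monic irreducible factors of the characteristic polynomial. -/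
noncomputable def factors : Finset ℤ[X] :=
  (UniqueFactorizationMonoid.normalizedFactors A.charpoly).toFinset

open Classical in
/-- The `r`-primary part of the characteristic polynomial. -/
noncomputable def factorPow (r : ℤ[X]) : ℤ[X] :=
  r ^ (UniqueFactorizationMonoid.normalizedFactors A.charpoly).count r

/-- The product of the `r`-primary parts of the characteristic polynomial for `r ∈ S`. -/
noncomputable def factorProd (S : Finset ℤ[X]) : ℤ[X] := ∏ r ∈ S, factorPow A r

/-- The factors `r` of the characteristic polynomial with `m ∣ r ^ u` at `0`. -/
noncomputable def factorsAt (m : ℕ) : Finset ℤ[X] :=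
  {r ∈ factors A | (m : ℤ) ∣ (factorPow A r).eval 0}

lemma polyH_eq_factorProd (m : ℕ) : polyH A m = factorProd A (factorsAt A m) := by
  unfold polyH factorProd factorsAt factors factorPow
  congr!

lemma factorsAt_subset (m : ℕ) : factorsAt A m ⊆ factors A := Finset.filter_subset _ _

variable {A}

lemma mem_factors {r : ℤ[X]} :
    r ∈ factors A ↔ r ∈ UniqueFactorizationMonoid.normalizedFactors A.charpoly :=
  Multiset.mem_toFinset

lemma irreducible_of_mem_factors {r : ℤ[X]} (hr : r ∈ factors A) : Irreducible r :=
  UniqueFactorizationMonoid.irreducible_of_normalized_factor r (mem_factors.mp hr)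

lemma monic_of_mem_factors {r : ℤ[X]} (hr : r ∈ factors A) : r.Monic := by
  classical
  have hr' := mem_factors.mp hr
  have h1 := UniqueFactorizationMonoid.normalize_normalized_factor r hr'
  have h2 : IsUnit r.leadingCoeff := by
    obtain ⟨s, hs⟩ := UniqueFactorizationMonoid.dvd_of_mem_normalizedFactors hr'
    refine IsUnit.of_mul_eq_one s.leadingCoeff ?_
    rw [← leadingCoeff_mul, ← hs, A.charpoly_monic.leadingCoeff]
  have h3 := congrArg leadingCoeff h1
  rw [leadingCoeff_normalize, normalize_eq_one.mpr h2] at h3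
  exact h3.symm

lemma count_ne_zero_of_mem_factors [DecidableEq ℤ[X]] {r : ℤ[X]} (hr : r ∈ factors A) :
    (UniqueFactorizationMonoid.normalizedFactors A.charpoly).count r ≠ 0 := by
  rw [Multiset.count_ne_zero]
  exact mem_factors.mp hr

lemma factorPow_monic {r : ℤ[X]} (hr : r ∈ factors A) : (factorPow A r).Monic :=
  (monic_of_mem_factors hr).pow _

lemma factorProd_monic {S : Finset ℤ[X]} (hS : S ⊆ factors A) : (factorProd A S).Monic :=
  monic_prod_of_monic _ _ fun _ hr => factorPow_monic (hS hr)

variable (A) in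
lemma factorProd_factors : factorProd A (factors A) = A.charpoly := by
  classical
  refine eq_of_monic_of_associated (factorProd_monic subset_rfl) A.charpoly_monic ?_
  have h := UniqueFactorizationMonoid.prod_normalizedFactors A.charpoly_monic.ne_zero
  rw [Finset.prod_multiset_count] at h
  unfold factorProd factors factorPow
  convert h

lemma factorProd_mul_sdiff [DecidableEq ℤ[X]] {S : Finset ℤ[X]} (hS : S ⊆ factors A) :
    factorProd A S * factorProd A (factors A \ S) = A.charpoly := by
  rw [← factorProd_factors, mul_comm]
  exact Finset.prod_sdiff hS

lemma dvd_eval_factorPow_iff {p : ℕ} (hp : p.Prime) {r : ℤ[X]} (hr : r ∈ factors A) :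
    (p : ℤ) ∣ (factorPow A r).eval 0 ↔ (p : ℤ) ∣ r.eval 0 := by
  classical
  rw [factorPow, eval_pow]
  exact (Nat.prime_iff_prime_int.mp hp).dvd_pow_iff_dvd (count_ne_zero_of_mem_factors hr)

lemma mem_factorsAt {p : ℕ} (hp : p.Prime) {r : ℤ[X]} :
    r ∈ factorsAt A p ↔ r ∈ factors A ∧ (p : ℤ) ∣ r.eval 0 := by
  rw [factorsAt, Finset.mem_filter, and_congr_right_iff]
  exact fun hr => dvd_eval_factorPow_iff hp hr

variable (K : Type*) [Field K] [CharZero K]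

lemma isCoprime_factorProd {S S' : Finset ℤ[X]} (hS : S ⊆ factors A) (hS' : S' ⊆ factors A)
    (h : Disjoint S S') : IsCoprime ((factorProd A S).map (Int.castRingHom K))
      ((factorProd A S').map (Int.castRingHom K)) := by
  classical
  simp only [factorProd, factorPow, Polynomial.map_prod, Polynomial.map_pow]
  refine IsCoprime.prod_left fun r hr => IsCoprime.prod_right fun s hs => IsCoprime.pow ?_
  refine isCoprime_map_of_not_dvd K (irreducible_of_mem_factors (hS hr))
    (monic_of_mem_factors (hS hr)) fun hrs => ?_
  have h1 := (irreducible_of_mem_factors (hS hr)).associated_of_dvd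
    (irreducible_of_mem_factors (hS' hs)) hrs
  have h2 := eq_of_monic_of_associated (monic_of_mem_factors (hS hr))
    (monic_of_mem_factors (hS' hs)) h1
  exact Finset.disjoint_left.mp h hr (h2 ▸ hs)

/-- An irreducible r with p ∣ r(0) cannot divide P when p ∤ P(0). -/
lemma isCoprime_polyH {p : ℕ} (hp : p.Prime) {P : ℤ[X]} (hP : ¬ (p : ℤ) ∣ P.eval 0) :
    IsCoprime ((polyH A p).map (Int.castRingHom K)) (P.map (Int.castRingHom K)) := by
  classical
  rw [polyH_eq_factorProd]
  simp only [factorProd, factorPow, Polynomial.map_prod, Polynomial.map_pow]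
  refine IsCoprime.prod_left fun r hr => IsCoprime.pow_left ?_
  obtain ⟨h1, h2⟩ := (mem_factorsAt hp).mp hr
  exact isCoprime_map_of_dvd_eval K (irreducible_of_mem_factors h1) (monic_of_mem_factors h1) h2 hP

lemma not_dvd_eval_factorProd_sdiff [DecidableEq ℤ[X]] {p : ℕ} (hp : p.Prime) :
    ¬ (p : ℤ) ∣ (factorProd A (factors A \ factorsAt A p)).eval 0 := by
  rw [factorProd, eval_prod, (Nat.prime_iff_prime_int.mp hp).dvd_finsetProd_iff]
  rintro ⟨r, hr, h⟩
  rw [Finset.mem_sdiff] at hr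
  exact hr.2 (Finset.mem_filter.mpr ⟨hr.1, h⟩)

end Factors

/-! ### Transfer of kernels along T -/

section Transfer

variable {n : ℕ} {A B : Matrix (Fin n) (Fin n) ℤ} {K : Type*} [Field K] [CharZero K]

/-- An isomorphism `G_A → G_B` maps `ker h_{A,p}(A)` into `ker h_{B,p}(B)`. -/
lemma aeval_polyH_mulVec_eq_zero (hA : A.det ≠ 0) (hB : B.det ≠ 0)
    {T : Matrix (Fin n) (Fin n) ℚ} (hT : (fun v => T.mulVec v) '' groupG A = groupG B)
    {p : ℕ} (hp : p.Prime) {x : Fin n → K}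
    (hx : (aeval (A.map (Int.cast : ℤ → K)) (polyH A p)).mulVec x = 0) :
    (aeval (B.map (Int.cast : ℤ → K)) (polyH B p)).mulVec
      ((T.map (algebraMap ℚ K)).mulVec x) = 0 := by
  classical
  have : Fact p.Prime := ⟨hp⟩
  set N : Matrix (Fin n) (Fin n) ℚ := aeval (B.map (Int.cast : ℤ → ℚ)) (polyH B p) with hN
  have hcast : ∀ (C : Matrix (Fin n) (Fin n) ℤ) (P : ℤ[X]), aeval (C.map (Int.cast : ℤ → K)) P =
      (aeval (C.map (Int.cast : ℤ → ℚ)) P).map (algebraMap ℚ K) := fun C P => by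
    rw [aeval_map_intCast, aeval_map_intCast]
    ext i j
    simp
  -- The cofactor of h_{B,p} kills each row of N = h_{B,p}(B) by Cayley–Hamilton, and its constant
  -- term is prime to p.
  have hbd : ∀ i, IsBoundedAt p (groupG B) (N i) := fun i => by
    refine isBoundedAt_of_vecMul_aeval_eq_zero hB
      (not_dvd_eval_factorProd_sdiff (A := B) hp) ?_
    have h1 : N * aeval (B.map (Int.cast : ℤ → ℚ)) (factorProd B (factors B \ factorsAt B p)) = 0 := by
      rw [hN, ← map_mul, polyH_eq_factorProd, factorProd_mul_sdiff (factorsAt_subset B p),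
        aeval_charpoly_map_intCast]
    exact congrFun h1 i
  rw [hcast, ← hN]
  ext i
  obtain ⟨P, hP, hw⟩ := exists_vecMul_aeval_eq_zero hA
    ((isBoundedAt_groupG_iff hT _).mp (hbd i))
  obtain ⟨U, V, hUV⟩ := isCoprime_polyH (A := A) K hp hP
  set M := A.map (Int.cast : ℤ → K) with hM
  -- By Bézout x lies in the image of P(A), which the transported row kills.
  have h1 : x = (aeval M P).mulVec ((aeval M V).mulVec x) := by
    have h2 := congrArg (fun q => (aeval M q).mulVec x) hUV
    rw [mul_comm V] at h2
    simp only [map_add, map_mul, map_one, aeval_map_intCastRingHom, Matrix.add_mulVec,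
      ← Matrix.mulVec_mulVec, hx, Matrix.mulVec_zero, zero_add, Matrix.one_mulVec] at h2
    exact h2.symm
  have h3 : Matrix.vecMul (fun j => algebraMap ℚ K (N i j))
      ((T.map (algebraMap ℚ K)) * aeval M P) = 0 := by
    rw [Matrix.vecMul_vecMul] at hw
    rw [hM, hcast, ← Matrix.map_mul]
    ext j
    have := congrArg (algebraMap ℚ K) (congrFun hw j)
    simpa [Matrix.vecMul, dotProduct] using this
  change (fun j => algebraMap ℚ K (N i j)) ⬝ᵥ _ = 0
  rw [h1, Matrix.mulVec_mulVec, Matrix.dotProduct_mulVec, h3, zero_dotProduct]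

end Transfer
-- Generalized eigenspaces and kernels of polynomials
section LinearAlgebra

variable {K V : Type*} [Field K] [AddCommGroup V] [Module K V] (f : Module.End K V)

lemma ker_aeval_prod_X_sub_C_pow [DecidableEq K] (s : Finset K) (m : K → ℕ) :
    LinearMap.ker (aeval f (∏ a ∈ s, (X - C a) ^ m a)) ≤ ⨆ a ∈ s, f.maxGenEigenspace a := by
  induction s using Finset.induction_on with
  | empty => simp [Module.End.one_eq_id]
  | insert a s ha ih =>
    rw [Finset.prod_insert ha, Finset.iSup_insert, ← sup_ker_aeval_eq_ker_aeval_mul_of_coprime]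
    · refine sup_le_sup ?_ ih
      intro v hv
      rw [Module.End.mem_maxGenEigenspace]
      refine ⟨m a, ?_⟩
      simpa [Algebra.algebraMap_eq_smul_one] using hv
    · refine IsCoprime.prod_right fun b hb => IsCoprime.pow ?_
      refine isCoprime_X_sub_C_of_isUnit_sub (IsUnit.mk0 _ (sub_ne_zero.mpr ?_))
      rintro rfl
      exact ha hb

lemma ker_aeval_le_iSup_maxGenEigenspace [DecidableEq K] {Q : K[X]} (hQ : Q.Splits)
    (hm : Q.Monic) :
    LinearMap.ker (aeval f Q) ≤ ⨆ a ∈ Q.roots.toFinset, f.maxGenEigenspace a := by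
  have h1 := hQ.eq_prod_roots
  rw [hm.leadingCoeff, C_1, one_mul, Finset.prod_multiset_map_count] at h1
  conv_lhs => rw [h1]
  exact ker_aeval_prod_X_sub_C_pow f _ _

/-- If (f - a)ᵏv = 0, then Q(f)v is killed both by (f - a)ᵏ and by R(f), which are coprime since
R(a) ≠ 0. -/
lemma maxGenEigenspace_le_ker_aeval {Q R : K[X]} (h : aeval f (Q * R) = 0) {a : K}
    (ha : R.eval a ≠ 0) : f.maxGenEigenspace a ≤ LinearMap.ker (aeval f Q) := by
  intro v hv
  rw [Module.End.mem_maxGenEigenspace] at hv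
  obtain ⟨k, hk⟩ := hv
  have h1 : IsCoprime ((X - C a) ^ k) R := by
    refine IsCoprime.pow_left ((irreducible_X_sub_C a).coprime_iff_not_dvd.mpr ?_)
    rwa [dvd_iff_isRoot]
  refine Submodule.disjoint_def.mp (disjoint_ker_aeval_of_isCoprime f h1) _ ?_ ?_
  · rw [LinearMap.mem_ker, ← Module.End.mul_apply, ← map_mul, mul_comm, map_mul,
      Module.End.mul_apply]
    have : aeval f ((X - C a) ^ k) v = 0 := by
      simpa [Algebra.algebraMap_eq_smul_one] using hk
    rw [this, map_zero]
  · rw [LinearMap.mem_ker, ← Module.End.mul_apply, ← map_mul, mul_comm, h, LinearMap.zero_apply]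

variable [FiniteDimensional K V]

lemma finrank_biSup_le {ι : Type*} [DecidableEq ι] (s : Finset ι) (W : ι → Submodule K V) :
    Module.finrank K (⨆ a ∈ s, W a : Submodule K V) ≤ ∑ a ∈ s, Module.finrank K (W a) := by
  induction s using Finset.induction_on with
  | empty => simp
  | insert a s ha ih =>
    rw [Finset.sum_insert ha, Finset.iSup_insert]
    exact (Submodule.finrank_add_le_finrank_add_finrank _ _).trans (Nat.add_le_add_left ih _)

lemma finrank_ker_aeval_le {Q R : K[X]} (hQm : Q.Monic) (hQ : Q.Splits) (hQR : IsCoprime Q R)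
    (h : Q * R = f.charpoly) : Module.finrank K (LinearMap.ker (aeval f Q)) ≤ Q.natDegree := by
  classical
  refine (Submodule.finrank_mono (ker_aeval_le_iSup_maxGenEigenspace f hQ hQm)).trans ?_
  refine (finrank_biSup_le _ _).trans ?_
  rw [hQ.natDegree_eq_card_roots, ← Multiset.toFinset_sum_count_eq]
  refine (Finset.sum_congr rfl fun a ha => ?_).le
  -- A root of Q is not a root of R, so its multiplicity in the characteristic polynomial is that in
  -- Q.
  rw [LinearMap.finrank_maxGenEigenspace_eq, ← h, rootMultiplicity_mul, count_roots]
  · rw [Nat.add_eq_left, rootMultiplicity_eq_zero]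
    intro hR
    rw [Multiset.mem_toFinset, mem_roots hQm.ne_zero] at ha
    obtain ⟨u, v, huv⟩ := hQR
    have := congrArg (eval a) huv
    rw [IsRoot.def] at hR ha
    simp [hR, ha] at this
  · rw [h]
    exact f.charpoly_monic.ne_zero

/-- If the characteristic polynomial of `f` is a product of coprime factors `Q`, `R`, then
`ker Q(f)` has dimension `deg Q`. -/
lemma finrank_ker_aeval_eq {Q R : K[X]} (hQm : Q.Monic) (hRm : R.Monic) (hQR : IsCoprime Q R)
    (h : Q * R = f.charpoly) (hs : f.charpoly.Splits) :
    Module.finrank K (LinearMap.ker (aeval f Q)) = Q.natDegree := by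
  have h0 := f.charpoly_monic.ne_zero
  have hQ := finrank_ker_aeval_le f hQm (hs.of_dvd h0 ⟨R, h.symm⟩) hQR h
  have hR := finrank_ker_aeval_le f hRm (hs.of_dvd h0 ⟨Q, by rw [mul_comm, h]⟩) hQR.symm
    (by rw [mul_comm, h])
  have h1 : LinearMap.ker (aeval f Q) ⊔ LinearMap.ker (aeval f R) = ⊤ := by
    rw [sup_ker_aeval_eq_ker_aeval_mul_of_coprime f hQR, h, LinearMap.aeval_self_charpoly,
      LinearMap.ker_zero]
  -- The two kernels span V and the upper bounds on their dimensions add up to dim V, so both bounds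
  -- are attained.
  have h2 := Submodule.finrank_add_le_finrank_add_finrank (LinearMap.ker (aeval f Q))
    (LinearMap.ker (aeval f R))
  rw [h1, finrank_top, ← f.charpoly_natDegree, ← h, hQm.natDegree_mul hRm] at h2
  omega

end LinearAlgebra

/-! ### Intersections of kernels and their dimensions -/

section IntEnd

variable {n : ℕ} {A B : Matrix (Fin n) (Fin n) ℤ} {K : Type*} [Field K]

lemma mem_ker_aeval_intEnd {P : ℤ[X]} {x : Fin n → K} :
    x ∈ LinearMap.ker (aeval (intEnd K A) (P.map (Int.castRingHom K))) ↔
      (aeval (A.map (Int.cast : ℤ → K)) P).mulVec x = 0 := by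
  have h : intEnd K A = Matrix.toLinAlgEquiv' (A.map (Int.cast : ℤ → K)) := rfl
  rw [h, aeval_algHom_apply, aeval_map_intCastRingHom, LinearMap.mem_ker,
    Matrix.toLinAlgEquiv'_apply]

variable (A K) in
lemma charpoly_intEnd : (intEnd K A).charpoly = A.charpoly.map (Int.castRingHom K) := by
  rw [intEnd, Matrix.charpoly_toLin', ← Matrix.charpoly_map]
  rfl

variable [CharZero K]

lemma factorProd_eq_zero_of_forall {k : ℕ} (S : Fin k → Finset ℤ[X]) {S₀ : Finset ℤ[X]}
    (hS : ∀ i, S i ⊆ factors A) (hS₀ : ∀ r, r ∈ S₀ ↔ r ∈ factors A ∧ ∀ i, r ∈ S i)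
    {x : Fin n → K} :
    (∀ i, (aeval (A.map (Int.cast : ℤ → K)) (factorProd A (S i))).mulVec x = 0) ↔
      (aeval (A.map (Int.cast : ℤ → K)) (factorProd A S₀)).mulVec x = 0 := by
  classical
  set M := A.map (Int.cast : ℤ → K)
  have hS₀' : S₀ ⊆ factors A := fun r hr => ((hS₀ r).mp hr).1
  constructor
  · intro h
    -- Applied to y = h_{S₀}(A)x: each r ∉ S₀ is missing from some S i, hence its primary part is
    -- coprime to the product over S i, which kills y. These parts can thus be peeled off one by
    -- one.
    have key : ∀ s : Finset ℤ[X], s ⊆ factors A \ S₀ → ∀ y : Fin n → K,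
        (∀ i, (aeval M (factorProd A (S i))).mulVec y = 0) →
        (aeval M (factorProd A s)).mulVec y = 0 → y = 0 := by
      intro s
      induction s using Finset.induction_on with
      | empty =>
        intro _ y _ hy
        simpa [factorProd] using hy
      | insert r s hr ih =>
        intro hs y hy hy'
        have hrm := Finset.mem_sdiff.mp (hs (Finset.mem_insert_self r s))
        obtain ⟨i, hi⟩ : ∃ i, r ∉ S i := by
          by_contra! hcon
          exact hrm.2 ((hS₀ r).mpr ⟨hrm.1, hcon⟩)
        have hcomm : ∀ P Q : ℤ[X], (aeval M P).mulVec ((aeval M Q).mulVec y) =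
            (aeval M Q).mulVec ((aeval M P).mulVec y) := fun P Q => by
          rw [Matrix.mulVec_mulVec, Matrix.mulVec_mulVec, ← map_mul, mul_comm, map_mul]
        refine ih ((Finset.subset_insert r s).trans hs) y hy ?_
        refine eq_zero_of_isCoprime (M := M) (P := factorProd A {r}) (Q := factorProd A (S i))
          (isCoprime_factorProd K (by simpa using hrm.1) (hS i) (by simpa using hi)) ?_ ?_
        · rw [Matrix.mulVec_mulVec, ← map_mul]
          have : factorProd A {r} * factorProd A s = factorProd A (insert r s) := by
            simp [factorProd, Finset.prod_insert hr]
          rw [this, hy']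
        · rw [hcomm, hy, Matrix.mulVec_zero]
    refine key _ subset_rfl _ (fun i => ?_) ?_
    · rw [Matrix.mulVec_mulVec, ← map_mul, mul_comm, map_mul, ← Matrix.mulVec_mulVec, h,
        Matrix.mulVec_zero]
    · rw [Matrix.mulVec_mulVec, ← map_mul, mul_comm, factorProd_mul_sdiff hS₀',
        aeval_charpoly_map_intCast, Matrix.zero_mulVec]
  · intro h i
    have hsub : S₀ ⊆ S i := fun r hr => ((hS₀ r).mp hr).2 i
    have : factorProd A (S i) = factorProd A (S i \ S₀) * factorProd A S₀ :=
      (Finset.prod_sdiff hsub).symm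
    rw [this, map_mul, ← Matrix.mulVec_mulVec, h, Matrix.mulVec_zero]

lemma mem_factorsAt_prod {k : ℕ} {p : Fin k → ℕ} (hinj : Function.Injective p)
    (hp : ∀ i, (p i).Prime) (r : ℤ[X]) :
    r ∈ factorsAt A (∏ i, p i) ↔ r ∈ factors A ∧ ∀ i, r ∈ factorsAt A (p i) := by
  have : ((∏ i, p i : ℕ) : ℤ) ∣ (factorPow A r).eval 0 ↔
      ∀ i, ((p i : ℕ) : ℤ) ∣ (factorPow A r).eval 0 := by
    constructor
    · intro h i
      exact (Int.natCast_dvd_natCast.mpr (Finset.dvd_prod_of_mem p (Finset.mem_univ i))).trans h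
    · intro h
      push_cast
      refine Finset.prod_dvd_of_coprime (fun i _ j _ hij => ?_) fun i _ => h i
      exact Nat.isCoprime_iff_coprime.mpr ((Nat.coprime_primes (hp i) (hp j)).mpr (hinj.ne hij))
  simp only [factorsAt, Finset.mem_filter, this]
  constructor
  · exact fun h => ⟨h.1, fun i => ⟨h.1, h.2 i⟩⟩
  · exact fun h => ⟨h.1, fun i => (h.2 i).2⟩

lemma mem_ker_aeval_polyH_prod {k : ℕ} {p : Fin k → ℕ} (hinj : Function.Injective p)
    (hp : ∀ i, (p i).Prime) {x : Fin n → K} :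
    x ∈ LinearMap.ker (aeval (intEnd K A) ((polyH A (∏ i, p i)).map (Int.castRingHom K))) ↔
      ∀ i, (aeval (A.map (Int.cast : ℤ → K)) (polyH A (p i))).mulVec x = 0 := by
  rw [mem_ker_aeval_intEnd]
  simp only [polyH_eq_factorProd]
  exact (factorProd_eq_zero_of_forall (fun i => factorsAt A (p i))
    (fun i => factorsAt_subset A _) (mem_factorsAt_prod hinj hp)).symm

lemma finrank_ker_aeval_polyH (m : ℕ) (hs : (A.charpoly.map (Int.castRingHom K)).Splits) :
    Module.finrank K
      (LinearMap.ker (aeval (intEnd K A) ((polyH A m).map (Int.castRingHom K)))) =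
      (polyH A m).natDegree := by
  classical
  have hsub := factorsAt_subset A m
  have hm := factorProd_monic hsub
  rw [polyH_eq_factorProd, ← hm.natDegree_map (Int.castRingHom K)]
  refine finrank_ker_aeval_eq _ (R := (factorProd A (factors A \ factorsAt A m)).map
    (Int.castRingHom K)) (hm.map _) ((factorProd_monic Finset.sdiff_subset).map _)
    (isCoprime_factorProd K hsub Finset.sdiff_subset Finset.disjoint_sdiff) ?_ ?_
  · rw [← Polynomial.map_mul, factorProd_mul_sdiff hsub, charpoly_intEnd]
  · rwa [charpoly_intEnd]

end IntEnd
-- The space X_{A,p} as a kernel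
section NumberField

open NumberField

variable {n : ℕ} {A B : Matrix (Fin n) (Fin n) ℤ} {K : Type*} [Field K]

lemma galoisImage_mem_maxGenEigenspace [CharZero K] (σ : K ≃ₐ[ℚ] K) {l : K} {v : Fin n → K}
    (hv : v ∈ (intEnd K A).maxGenEigenspace l) :
    (fun i => σ (v i)) ∈ (intEnd K A).maxGenEigenspace (σ l) := by
  rw [Module.End.mem_maxGenEigenspace] at hv ⊢
  obtain ⟨k, hk⟩ := hv
  refine ⟨k, ?_⟩
  set f : Module.End K (Fin n → K) := intEnd K A - l • 1 with hf
  set g : Module.End K (Fin n → K) := intEnd K A - σ l • 1 with hg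
  have h1 : ∀ w : Fin n → K, (fun i => σ (f w i)) = g (fun i => σ (w i)) := by
    intro w
    ext i
    simp [hf, hg, intEnd, Matrix.mulVec, dotProduct]
  have h2 : ∀ (k : ℕ) (w : Fin n → K),
      (fun i => σ ((f ^ k) w i)) = (g ^ k) (fun i => σ (w i)) := by
    intro k
    induction k with
    | zero => simp
    | succ k ih =>
      intro w
      rw [pow_succ, Module.End.mul_apply, ih, h1, pow_succ, Module.End.mul_apply]
  rw [← h2, hk]
  ext i
  simp

lemma intCast_eval_mem {R : Type*} [CommRing R] (I : Ideal R) {l : R} (hl : l ∈ I) {r : ℤ[X]}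
    (hr : aeval l r = 0) : algebraMap ℤ R (r.eval 0) ∈ I := by
  rw [← r.divX_mul_X_add, map_add, map_mul, aeval_X, aeval_C, coeff_zero_eq_eval_zero] at hr
  rw [eq_neg_of_add_eq_zero_right hr]
  exact I.neg_mem (I.mul_mem_left _ hl)

/-- Up to sign r(0) is the product of the roots of r, which are algebraic integers; as it lies in
the prime 𝔭, so does one of them. -/
lemma exists_root_mem {p : ℕ} {𝔭 : Ideal (𝓞 K)} [h𝔭 : 𝔭.IsPrime]
    [𝔭.LiesOver (Ideal.span {(p : ℤ)})] {r : ℤ[X]} (hm : r.Monic) (hp : (p : ℤ) ∣ r.eval 0)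
    (hs : (r.map (Int.castRingHom K)).Splits) :
    ∃ l ∈ 𝔭, (r.map (Int.castRingHom K)).eval (l : K) = 0 := by
  have hint : ∀ a ∈ (r.map (Int.castRingHom K)).roots, ∃ b : 𝓞 K, (b : K) = a := by
    intro a ha
    have ha' : IsIntegral ℤ a := ⟨r, hm, by
      rw [← eval_map]
      exact (mem_roots (hm.map _).ne_zero).mp ha⟩
    exact ⟨⟨a, ha'⟩, rfl⟩
  have : CanLift K (𝓞 K) (algebraMap (𝓞 K) K) (fun a => ∃ b : 𝓞 K, (b : K) = a) :=
    ⟨fun _ h => h⟩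
  obtain ⟨t, ht⟩ : ∃ t : Multiset (𝓞 K), t.map (algebraMap (𝓞 K) K) =
      (r.map (Int.castRingHom K)).roots :=
    CanLift.prf _ hint
  have h1 := hs.coeff_zero_eq_prod_roots_of_monic (hm.map _)
  rw [coeff_map, ← ht, ← map_multiset_prod] at h1
  have h2 : algebraMap ℤ (𝓞 K) (r.coeff 0) =
      (-1) ^ (r.map (Int.castRingHom K)).natDegree * t.prod := by
    apply FaithfulSMul.algebraMap_injective (𝓞 K) K
    simpa using h1
  have h3 : algebraMap ℤ (𝓞 K) (r.coeff 0) ∈ 𝔭 := by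
    rw [← Ideal.mem_of_liesOver 𝔭 (Ideal.span {(p : ℤ)}), Ideal.mem_span_singleton,
      coeff_zero_eq_eval_zero]
    exact hp
  rw [h2, Ideal.unit_mul_mem_iff_mem _ ((isUnit_one.neg).pow _),
    h𝔭.multiset_prod_mem_iff_exists_mem] at h3
  obtain ⟨l, hl, hl𝔭⟩ := h3
  refine ⟨l, hl𝔭, ?_⟩
  have : (l : K) ∈ (r.map (Int.castRingHom K)).roots := by
    rw [← ht]
    exact Multiset.mem_map_of_mem _ hl
  exact (mem_roots (hm.map _).ne_zero).mp this

lemma exists_algEquiv_of_roots [CharZero K] [IsGalois ℚ K] {r : ℤ[X]} (hr : Irreducible r) (hm : r.Monic)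
    {a b : K} (ha : (r.map (Int.castRingHom K)).eval a = 0)
    (hb : (r.map (Int.castRingHom K)).eval b = 0) : ∃ σ : K ≃ₐ[ℚ] K, σ a = b := by
  have h1 : Irreducible (r.map (algebraMap ℤ ℚ)) :=
    (hm.irreducible_iff_irreducible_map_fraction_map).mp hr
  have h2 : ∀ c : K, (r.map (Int.castRingHom K)).eval c = 0 →
      r.map (algebraMap ℤ ℚ) = minpoly ℚ c := fun c hc => by
    refine minpoly.eq_of_irreducible_of_monic h1 ?_ (hm.map _)
    rw [aeval_map_algebraMap, aeval_def, ← eval_map, algebraMap_int_eq]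
    exact hc
  exact isConjRoot_iff_exists_algEquiv.mp ((h2 b hb).symm.trans (h2 a ha))

variable [NumberField K]

/-- `X_{A,p}` is the kernel of `h_{A,p}(A)`. -/
lemma spaceX_eq_ker [IsGalois ℚ K] (hs : (A.charpoly.map (Int.castRingHom K)).Splits) {p : ℕ}
    (hp : p.Prime) (𝔭 : Ideal (𝓞 K)) [h𝔭 : 𝔭.IsPrime] [𝔭.LiesOver (Ideal.span {(p : ℤ)})] :
    spaceX A 𝔭 =
      LinearMap.ker (aeval (intEnd K A) ((polyH A p).map (Int.castRingHom K))) := by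
  classical
  have hsub := factorsAt_subset A p
  have hm := factorProd_monic hsub
  rw [polyH_eq_factorProd]
  apply le_antisymm
  · refine iSup_le fun σ => ?_
    rintro _ ⟨v, hv, rfl⟩
    have hle : ∀ l ∈ 𝔭, (intEnd K A).maxGenEigenspace (l : K) ≤
        (LinearMap.ker (aeval (intEnd K A) ((factorProd A (factorsAt A p)).map
          (Int.castRingHom K)))) := by
      intro l hl
      refine maxGenEigenspace_le_ker_aeval _
        (R := (factorProd A (factors A \ factorsAt A p)).map (Int.castRingHom K)) ?_ ?_
      · rw [← Polynomial.map_mul, factorProd_mul_sdiff hsub, ← charpoly_intEnd,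
          LinearMap.aeval_self_charpoly]
      · intro h0
        -- A polynomial with a root in 𝔭 has its constant term in 𝔭 ∩ ℤ = pℤ, which is excluded for
        -- the cofactor.
        refine not_dvd_eval_factorProd_sdiff (A := A) hp ?_
        rw [← Ideal.mem_span_singleton, Ideal.mem_of_liesOver 𝔭 (Ideal.span {(p : ℤ)})]
        refine intCast_eval_mem 𝔭 hl ?_
        apply FaithfulSMul.algebraMap_injective (𝓞 K) K
        rw [map_zero, ← aeval_algebraMap_apply, aeval_def, ← eval_map, algebraMap_int_eq]
        exact h0
    have hv' : v ∈ spaceXIdeal A 𝔭 := hv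
    have h1 := mem_ker_aeval_intEnd.mp (iSup₂_le (a := LinearMap.ker _) hle hv')
    rw [mem_ker_aeval_intEnd]
    rw [aeval_map_intCast] at h1 ⊢
    ext i
    -- The matrix h_{A,p}(A) has integer entries, so σ preserves its kernel.
    have h2 := congrArg σ (congrFun h1 i)
    simpa [Matrix.mulVec, dotProduct] using h2
  · refine (ker_aeval_le_iSup_maxGenEigenspace _ (hs.of_dvd (A.charpoly_monic.map _).ne_zero ?_)
      (hm.map _)).trans ?_
    · rw [← factorProd_mul_sdiff hsub, Polynomial.map_mul]
      exact dvd_mul_right _ _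
    · refine iSup₂_le fun a ha v hv => ?_
      rw [Multiset.mem_toFinset, mem_roots (hm.map _).ne_zero, IsRoot.def, factorProd,
        Polynomial.map_prod, eval_prod, Finset.prod_eq_zero_iff] at ha
      obtain ⟨r, hr, hra⟩ := ha
      obtain ⟨hrA, hrp⟩ := (mem_factorsAt hp).mp hr
      rw [factorPow, Polynomial.map_pow, eval_pow] at hra
      have hra' := eq_zero_of_pow_eq_zero hra
      have hrm := monic_of_mem_factors hrA
      have hrs : (r.map (Int.castRingHom K)).Splits := by
        refine hs.of_dvd (A.charpoly_monic.map _).ne_zero (Polynomial.map_dvd _ ?_)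
        exact UniqueFactorizationMonoid.dvd_of_mem_normalizedFactors (mem_factors.mp hrA)
      obtain ⟨l, hl, hl0⟩ := exists_root_mem (𝔭 := 𝔭) hrm hrp hrs
      obtain ⟨σ, hσ⟩ := exists_algEquiv_of_roots (irreducible_of_mem_factors hrA) hrm hl0 hra'
      -- With a = σ(l) and l ∈ 𝔭, the vector σ⁻¹(v) lies in the generalized eigenspace of l.
      refine Submodule.mem_iSup_of_mem σ ⟨fun i => σ.symm (v i), ?_, by ext i; simp⟩
      refine Submodule.mem_iSup_of_mem l (Submodule.mem_iSup_of_mem hl ?_)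
      have := galoisImage_mem_maxGenEigenspace σ.symm hv
      rwa [← hσ, AlgEquiv.symm_apply_apply] at this

end NumberField
-- Equivalence of kernels and equality of degrees
section Transfer

variable {n : ℕ} {A B : Matrix (Fin n) (Fin n) ℤ} {K : Type*} [Field K] [CharZero K]

lemma aeval_polyH_mulVec_eq_zero_iff (hA : A.det ≠ 0) (hB : B.det ≠ 0)
    {T : Matrix (Fin n) (Fin n) ℚ} (hTu : IsUnit T.det)
    (hT : (fun v => T.mulVec v) '' groupG A = groupG B) {p : ℕ} (hp : p.Prime) {x : Fin n → K} :
    (aeval (A.map (Int.cast : ℤ → K)) (polyH A p)).mulVec x = 0 ↔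
      (aeval (B.map (Int.cast : ℤ → K)) (polyH B p)).mulVec
        ((T.map (algebraMap ℚ K)).mulVec x) = 0 := by
  refine ⟨aeval_polyH_mulVec_eq_zero hA hB hT hp, fun h => ?_⟩
  have := aeval_polyH_mulVec_eq_zero hB hA (image_groupG_symm hTu hT) hp h
  rwa [Matrix.mulVec_mulVec (v := x), ← Matrix.map_mul, Matrix.nonsing_inv_mul _ hTu,
    Matrix.map_one _ (map_zero _) (map_one _), Matrix.one_mulVec] at this

lemma ratEnd_bijective (T : GL (Fin n) ℚ) : Function.Bijective (ratEnd K T) := by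
  have h : ∀ S : GL (Fin n) ℚ, Function.LeftInverse (ratEnd K S⁻¹) (ratEnd K S) := fun S x => by
    rw [ratEnd, ratEnd, Matrix.toLin'_apply, Matrix.toLin'_apply, Matrix.mulVec_mulVec,
      ← Matrix.map_mul, ← Units.val_mul, inv_mul_cancel, Units.val_one,
      Matrix.map_one _ (map_zero _) (map_one _), Matrix.one_mulVec]
  refine ⟨(h T).injective, ?_⟩
  have h' := (h T⁻¹).surjective
  rwa [inv_inv] at h'

end Transfer

/-- The degrees involve no field, so an auxiliary one is chosen: over a splitting field of h_A h_B
they are dimensions of kernels that T identifies. -/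
theorem natDegree_polyH_prod_eq {n : ℕ} {A B : Matrix (Fin n) (Fin n) ℤ} (hA : A.det ≠ 0)
    (hB : B.det ≠ 0) (T : GL (Fin n) ℚ)
    (hT : (fun v => (T : Matrix (Fin n) (Fin n) ℚ).mulVec v) '' groupG A = groupG B)
    {k : ℕ} {p : Fin k → ℕ} (hinj : Function.Injective p) (hp : ∀ i, (p i).Prime) :
    (polyH A (∏ i, p i)).natDegree = (polyH B (∏ i, p i)).natDegree := by
  have hTu : IsUnit (T : Matrix (Fin n) (Fin n) ℚ).det := T.isUnit.map Matrix.detMonoidHom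
  let Q : ℚ[X] := (A.charpoly * B.charpoly).map (Int.castRingHom ℚ)
  let K := Q.SplittingField
  have hcomp : (algebraMap ℚ K).comp (Int.castRingHom ℚ) = Int.castRingHom K :=
    RingHom.ext_int _ _
  have hs : ((A.charpoly * B.charpoly).map (Int.castRingHom K)).Splits := by
    rw [← hcomp, ← Polynomial.map_map]
    exact SplittingField.splits Q
  have h0 : (A.charpoly * B.charpoly).map (Int.castRingHom K) ≠ 0 :=
    ((A.charpoly_monic.mul B.charpoly_monic).map _).ne_zero
  have hsA := hs.of_dvd h0 (Polynomial.map_dvd _ (dvd_mul_right A.charpoly B.charpoly))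
  have hsB := hs.of_dvd h0 (Polynomial.map_dvd _ (dvd_mul_left B.charpoly A.charpoly))
  rw [← finrank_ker_aeval_polyH _ hsA, ← finrank_ker_aeval_polyH _ hsB]
  let e := LinearEquiv.ofBijective (ratEnd K T) (ratEnd_bijective T)
  have hmap : (LinearMap.ker (aeval (intEnd K B) ((polyH B (∏ i, p i)).map
      (Int.castRingHom K)))).comap (ratEnd K T) =
      LinearMap.ker (aeval (intEnd K A) ((polyH A (∏ i, p i)).map (Int.castRingHom K))) := by
    ext x
    rw [Submodule.mem_comap, mem_ker_aeval_polyH_prod hinj hp, mem_ker_aeval_polyH_prod hinj hp]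
    exact forall_congr' fun i => (aeval_polyH_mulVec_eq_zero_iff hA hB hTu hT (hp i)).symm
  have hmap' := Submodule.map_comap_eq_of_surjective (ratEnd_bijective (K := K) T).2
    (LinearMap.ker (aeval (intEnd K B) ((polyH B (∏ i, p i)).map (Int.castRingHom K))))
  rw [hmap] at hmap'
  rw [← hmap']
  exact (LinearEquiv.finrank_map_eq e _).symm

end Solenoid

theorem lemma5p3 {n : ℕ} (A B : Matrix (Fin n) (Fin n) ℤ) (hA : A.det ≠ 0) (hB : B.det ≠ 0)
    (T : GL (Fin n) ℚ)
    (hT : (fun v => (T : Matrix (Fin n) (Fin n) ℚ).mulVec v) '' Solenoid.groupG A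
      = Solenoid.groupG B) :
    Solenoid.primesP' A = Solenoid.primesP' B ∧
    ∀ (k : ℕ) (p : Fin k → ℕ), Function.Injective p → (∀ i, p i ∈ Solenoid.primesP' A) →
      -- `K`: a finite Galois extension of `ℚ` containing all the eigenvalues of `A` and `B`;
      -- `𝔭 i`, `𝔮 i`: primes of `K` above `p i`
      (∀ (K : Type*) [Field K] [NumberField K] [IsGalois ℚ K],
        (A.charpoly.map (Int.castRingHom K)).Splits →
        (B.charpoly.map (Int.castRingHom K)).Splits →
        ∀ 𝔭 𝔮 : Fin k → Ideal (NumberField.RingOfIntegers K),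
          (∀ i, (𝔭 i).IsPrime ∧ (𝔭 i).LiesOver (Ideal.span {(p i : ℤ)})) →
          (∀ i, (𝔮 i).IsPrime ∧ (𝔮 i).LiesOver (Ideal.span {(p i : ℤ)})) →
          (Solenoid.spaceXMulti A 𝔭).map (Solenoid.ratEnd K T) = Solenoid.spaceXMulti B 𝔮) ∧
      (Solenoid.polyH A (∏ i, p i)).natDegree = (Solenoid.polyH B (∏ i, p i)).natDegree := by
  have hTu : IsUnit (T : Matrix (Fin n) (Fin n) ℚ).det := T.isUnit.map Matrix.detMonoidHom
  refine ⟨subset_antisymm (Solenoid.primesP'_subset hA hB hT hTu)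
    (Solenoid.primesP'_subset hB hA (Solenoid.image_groupG_symm hTu hT)
      (Matrix.isUnit_nonsing_inv_det _ hTu)), fun k p hinj hp => ⟨?_, ?_⟩⟩
  · intro K _ _ _ hsA hsB 𝔭 𝔮 h𝔭 h𝔮
    have hcomap : (Solenoid.spaceXMulti B 𝔮).comap (Solenoid.ratEnd K T) =
        Solenoid.spaceXMulti A 𝔭 := by
      ext x
      simp only [Submodule.mem_comap, Solenoid.spaceXMulti, Submodule.mem_iInf]
      refine forall_congr' fun i => ?_
      have := (h𝔭 i).1
      have := (h𝔭 i).2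
      have := (h𝔮 i).1
      have := (h𝔮 i).2
      have hpi := (hp i).1.1
      rw [Solenoid.spaceX_eq_ker hsA hpi, Solenoid.spaceX_eq_ker hsB hpi,
        Solenoid.mem_ker_aeval_intEnd, Solenoid.mem_ker_aeval_intEnd]
      exact (Solenoid.aeval_polyH_mulVec_eq_zero_iff hA hB hTu hT hpi).symm
    rw [← hcomap]
    exact Submodule.map_comap_eq_of_surjective (Solenoid.ratEnd_bijective T).2 _
  · exact Solenoid.natDegree_polyH_prod_eq hA hB T hT hinj fun i => (hp i).1.1
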